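/- Let $\Bbbk$ be a field, $n\ge 0$, $R=\Bbbk[x_1,\dots,x_n]$, and let $L\subseteq\mathbb Z^n$ be a lattice (a subgroup). Let $I_L=\langle x^u-x^v : u,v\in\mathbb N^n,\ u-v\in L\rangle\subseteq R$ be its lattice ideal, and let $L_{pure}$ be the subgroup of $L$ generated by $L\cap\mathbb N^n$. A binomial is a polynomial with exactly two monomial terms (with arbitrary nonzero coefficients). A Markov basis of $I_L$ is a minimal (with respect to inclusion) generating set of $I_L$ consisting of binomials whose cardinality is the least one among all such minimal generating sets. A binomial is indispensable if some nonzero constant multiple of it belongs to every Markov basis of $I_L$ (the constant may depend on the Markov basis); a monomial $x^u$ is indispensable if for every Markov basis $S$ of $I_L$ there is a $B\in S$ of which $x^u$ is a monomial term. If $\operatorname{rank}(L_{pure})>1$, then $I_L$ has no indispensable binomials, and its only indispensable monomial is $1=x^{\mathbf 0}$. If $\operatorname{rank}(L_{pure})=1$, then $I_L$ has, up to multiplication by a nonzero constant, exactly one indispensable binomial, and it has exactly two indispensable monomials. -/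

import Mathlib

namespace LatticeIdeal

open MvPolynomial

/-- The vector `u - v ∈ ℤⁿ` for exponent vectors `u, v ∈ ℕⁿ`. -/
def expDiff {n : ℕ} (u v : Fin n →₀ ℕ) : Fin n → ℤ :=
  fun i => (u i : ℤ) - (v i : ℤ)

/-- The lattice ideal `I_L = ⟨x^u - x^v : u - v ∈ L⟩` of `k[x₁, …, xₙ]`;
a lattice in `ℤⁿ` is a subgroup of `ℤⁿ`. -/
noncomputable def latticeIdeal (k : Type*) [Field k] {n : ℕ} (L : AddSubgroup (Fin n → ℤ)) :
    Ideal (MvPolynomial (Fin n) k) :=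
  Ideal.span {f | ∃ u v : Fin n →₀ ℕ, expDiff u v ∈ L ∧ f = monomial u 1 - monomial v 1}

/-- `L_pure`, the subgroup of `L` generated by `L⁺ = L ∩ ℕⁿ`. -/
def pureSublattice {n : ℕ} (L : AddSubgroup (Fin n → ℤ)) : AddSubgroup (Fin n → ℤ) :=
  AddSubgroup.closure {w | w ∈ L ∧ ∀ i, 0 ≤ w i}

/-- The rank of a lattice: its rank as a (finitely generated free) `ℤ`-module. -/
noncomputable def latticeRank {n : ℕ} (L : AddSubgroup (Fin n → ℤ)) : ℕ :=
  Module.finrank ℤ L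

/-- A binomial: a polynomial with exactly two monomial terms, with arbitrary nonzero
coefficients. -/
def IsBinomial {k : Type*} [Field k] {n : ℕ} (B : MvPolynomial (Fin n) k) : Prop :=
  ∃ (u v : Fin n →₀ ℕ) (a b : k), u ≠ v ∧ a ≠ 0 ∧ b ≠ 0 ∧ B = monomial u a + monomial v b

/-- `S` is a minimal system of binomial generators of the ideal `I`: it consists of binomials,
it generates `I`, and no proper subset of it generates `I`. -/
def IsMinimalBinomialGeneratingSet {k : Type*} [Field k] {n : ℕ}
    (I : Ideal (MvPolynomial (Fin n) k)) (S : Set (MvPolynomial (Fin n) k)) : Prop :=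
  (∀ B ∈ S, IsBinomial B) ∧ Ideal.span S = I ∧ ∀ T ⊂ S, Ideal.span T ≠ I

/-- A Markov basis of `I`: a minimal system of binomial generators whose cardinality is the least
one among all minimal systems of binomial generators of `I`. -/
def IsMarkovBasis {k : Type*} [Field k] {n : ℕ}
    (I : Ideal (MvPolynomial (Fin n) k)) (S : Set (MvPolynomial (Fin n) k)) : Prop :=
  IsMinimalBinomialGeneratingSet I S ∧
    ∀ T, IsMinimalBinomialGeneratingSet I T → S.encard ≤ T.encard

/-- An indispensable binomial of `I`: a binomial that appears, up to a (nonzero) constant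
multiple, in every Markov basis of `I`. -/
def IsIndispensableBinomial {k : Type*} [Field k] {n : ℕ}
    (I : Ideal (MvPolynomial (Fin n) k)) (B : MvPolynomial (Fin n) k) : Prop :=
  IsBinomial B ∧ ∀ S, IsMarkovBasis I S → ∃ c : k, c ≠ 0 ∧ c • B ∈ S

/-- The monomial `x^u` is indispensable for `I`: every Markov basis of `I` has an element
in which `x^u` occurs as a monomial term. -/
def IsIndispensableMonomial {k : Type*} [Field k] {n : ℕ}
    (I : Ideal (MvPolynomial (Fin n) k)) (u : Fin n →₀ ℕ) : Prop :=
  ∀ S, IsMarkovBasis I S → ∃ B ∈ S, u ∈ B.support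

end LatticeIdeal

/-!
The variables indexed by the support of `L⁺ = L ∩ ℕⁿ` are units modulo `I_L`, and a binomial of
`I_L` has either both or none of its monomials in these variables. Mapping to the group algebra of
`ℤⁿ / K` shows that the exponent differences of the elements of a generating set that involve only
these variables generate `L_pure`, so there are at least `rank L_pure` of them. In a Markov basis
they can be exchanged for the binomials `x^c - 1`, where `c` runs through a `ℤ`-basis `C ⊆ ℕⁿ` of
`L_pure`, while every other element is multiplied by a monomial `x^d ≡ 1` with `d` large. So an
indispensable monomial is `1` or `x^c` with `c` in every such `C`. If the rank is greater than `1`,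
all vectors of `C` can be made arbitrarily large; if it is `1`, then `C = {w}` is unique, and
every Markov basis contains exactly one element in these variables, a multiple of `x^w - 1`.
-/

namespace LatticeIdeal

open MvPolynomial

section Modules

theorem exists_basis_eq_smul {R M : Type*} [CommRing R] [IsDomain R] [IsPrincipalIdealRing R]
    [AddCommGroup M] [Module R M] [Module.Free R M] [Module.Finite R M] {x : M} (hx : x ≠ 0) :
    ∃ (b : Module.Basis (Fin (Module.finrank R M)) R M) (i : Fin (Module.finrank R M)) (r : R),
      x = r • b i := by
  obtain ⟨m, snf⟩ := Submodule.smithNormalForm (Module.finBasis R M) (Submodule.span R {x})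
  have hm : m = 1 := by
    have hspan := (LinearEquiv.toSpanNonzeroSingleton R M x hx).finrank_eq
    rw [Module.finrank_self, Module.finrank_eq_card_basis snf.bN, Fintype.card_fin] at hspan
    exact hspan.symm
  subst hm
  let y : Submodule.span R {x} := ⟨x, Submodule.mem_span_singleton_self x⟩
  refine ⟨snf.bM, snf.f 0, snf.bN.repr y 0 * snf.a 0, ?_⟩
  have hy := congrArg Subtype.val (snf.bN.sum_repr y)
  rw [Fin.sum_univ_one, Submodule.coe_smul, snf.snf, smul_smul] at hy
  exact hy.symm

theorem closure_range_add_zsmul_le {G ι : Type*} [AddCommGroup G] (b : ι → G) (i : ι)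
    (f : ι → ℤ) :
    AddSubgroup.closure (Set.range fun j => b j + f j • b i) ≤
      AddSubgroup.closure (Set.range b) := by
  rw [AddSubgroup.closure_le]
  rintro _ ⟨j, rfl⟩
  have hb (j : ι) : b j ∈ AddSubgroup.closure (Set.range b) :=
    AddSubgroup.subset_closure ⟨j, rfl⟩
  exact add_mem (hb j) (zsmul_mem (hb i) _)

theorem closure_range_add_zsmul {G ι : Type*} [AddCommGroup G] (b : ι → G) {i : ι}
    {f : ι → ℤ} (hf : f i = 0) :
    AddSubgroup.closure (Set.range fun j => b j + f j • b i) =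
      AddSubgroup.closure (Set.range b) := by
  refine le_antisymm (closure_range_add_zsmul_le b i f) ?_
  simpa [hf] using closure_range_add_zsmul_le (fun j => b j + f j • b i) i (-f)

theorem exists_sub_of_mem_closure_image {A G : Type*} [AddCommMonoid A] [AddCommGroup G]
    (φ : A →+ G) (M : AddSubmonoid A) {g : G} (hg : g ∈ AddSubgroup.closure (φ '' M)) :
    ∃ a ∈ M, ∃ b ∈ M, g = φ a - φ b := by
  induction hg using AddSubgroup.closure_induction with
  | mem _ h =>
    obtain ⟨a, ha, rfl⟩ := h
    exact ⟨a, ha, 0, M.zero_mem, by simp⟩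
  | zero => exact ⟨0, M.zero_mem, 0, M.zero_mem, by simp⟩
  | add _ _ _ _ hx hy =>
    obtain ⟨a, ha, b, hb, rfl⟩ := hx
    obtain ⟨c, hc, d, hd, rfl⟩ := hy
    exact ⟨a + c, M.add_mem ha hc, b + d, M.add_mem hb hd, by
      rw [map_add, map_add, add_sub_add_comm]⟩
  | neg _ _ hx =>
    obtain ⟨a, ha, b, hb, rfl⟩ := hx
    exact ⟨b, hb, a, ha, neg_sub _ _⟩

end Modules

section IntegerLattices

variable {n : ℕ}

theorem exists_generators_eq_zsmul {P : AddSubgroup (Fin n → ℤ)} {x : Fin n → ℤ} (hx : x ∈ P)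
    (hx0 : x ≠ 0) :
    ∃ (b : Fin (latticeRank P) → Fin n → ℤ) (i : Fin (latticeRank P)) (z : ℤ),
      AddSubgroup.closure (Set.range b) = P ∧ x = z • b i := by
  let N : Submodule ℤ (Fin n → ℤ) := AddSubgroup.toIntSubmodule P
  have hxN : (⟨x, hx⟩ : N) ≠ 0 := fun h => hx0 (congrArg Subtype.val h)
  obtain ⟨b, i, z, hz⟩ := exists_basis_eq_smul (R := ℤ) hxN
  have hb : AddSubgroup.closure (Set.range fun j => (b j : Fin n → ℤ)) = P := by
    apply AddSubgroup.toIntSubmodule.injective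
    rw [AddSubgroup.toIntSubmodule_closure, Set.range_comp' Subtype.val b, ← N.coe_subtype,
      Submodule.span_image, b.span_eq, Submodule.map_top, Submodule.range_subtype]
  exact ⟨_, i, z, hb, congrArg Subtype.val hz⟩

theorem latticeRank_le_encard {P : AddSubgroup (Fin n → ℤ)} {s : Set (Fin n → ℤ)}
    (h : P ≤ AddSubgroup.closure s) : (latticeRank P : ℕ∞) ≤ s.encard := by
  rcases s.finite_or_infinite with hs | hs
  · have := hs.fintype
    have hle : AddSubgroup.toIntSubmodule P ≤ Submodule.span ℤ s := by
      rw [← AddSubgroup.toIntSubmodule_closure]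
      exact AddSubgroup.toIntSubmodule.monotone h
    rw [Set.encard_eq_coe_toFinset_card, Nat.cast_le]
    exact (Submodule.finrank_mono hle).trans (finrank_span_le_card s)
  · simp [hs.encard_eq]

theorem exists_forall_lt_mul {ι κ : Type*} [Finite ι] [Finite κ] (y : ι → κ → ℤ) {x : κ → ℤ}
    {A : Set κ} (hx : ∀ i ∈ A, 0 < x i) : ∃ M : ℤ, ∀ j, ∀ i ∈ A, y j i < M * x i := by
  have h : ∀ᶠ M : ℤ in Filter.atTop, ∀ j, ∀ i, i ∈ A → y j i < M * x i := by
    simp only [Filter.eventually_all]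
    exact fun j i hi =>
      (Filter.tendsto_id.atTop_mul_const' (hx i hi)).eventually_gt_atTop (y j i)
  exact h.exists

theorem exists_generators_gt_on {P : AddSubgroup (Fin n → ℤ)} (hr : 1 < latticeRank P)
    {A : Set (Fin n)} {x : Fin n → ℤ} (hxP : x ∈ P) (hx0 : x ≠ 0) (hx : ∀ i ∈ A, 0 < x i)
    (m : ℤ) :
    ∃ b : Fin (latticeRank P) → Fin n → ℤ,
      AddSubgroup.closure (Set.range b) = P ∧ ∀ j, ∀ i ∈ A, m < b j i := by
  obtain ⟨b, j₀, z, hb, hxb⟩ := exists_generators_eq_zsmul hxP hx0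
  have : Nontrivial (Fin (latticeRank P)) := Fin.nontrivial_iff_two_le.2 hr
  obtain ⟨j₁, hj₁⟩ := exists_ne j₀
  obtain ⟨M, hM⟩ := exists_forall_lt_mul (fun j i => m + |b j₀ i| - b j i) hx
  -- Adding `M • x`, a multiple of `b j₀`, makes all generators but `b j₀` large on `A`; adding
  -- one of these to `b j₀` makes that one large too.
  let b' : Fin (latticeRank P) → Fin n → ℤ :=
    fun j => b j + (if j = j₀ then 0 else M * z) • b j₀
  have hb'₀ : b' j₀ = b j₀ := by simp [b']
  have hb' : ∀ j ≠ j₀, ∀ i ∈ A, m + |b j₀ i| < b' j i := by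
    intro j hj i hi
    have hbj : b' j = b j + M • x := by simp [b', hj, hxb, mul_smul]
    rw [hbj, Pi.add_apply, Pi.smul_apply, smul_eq_mul]
    linarith [hM j i hi]
  refine ⟨fun j => b' j + (if j = j₀ then 1 else 0 : ℤ) • b' j₁, ?_, fun j i hi => ?_⟩
  · rw [closure_range_add_zsmul b' (by simp [hj₁]), closure_range_add_zsmul b (by simp), hb]
  · by_cases hj : j = j₀
    · subst hj
      simp only [if_true, one_smul, Pi.add_apply, hb'₀]
      linarith [hb' j₁ hj₁ i hi, neg_abs_le (b j i)]
    · simp only [hj, if_false, zero_smul, add_zero]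
      linarith [hb' j hj i hi, abs_nonneg (b j₀ i)]

end IntegerLattices

section PureSublattice

variable {n : ℕ}

/-- The inclusion `ℕⁿ → ℤⁿ` of exponent vectors into the group containing the lattices. -/
noncomputable def expVec : (Fin n →₀ ℕ) →+ (Fin n → ℤ) where
  toFun u i := u i
  map_zero' := by ext; simp
  map_add' _ _ := by ext; simp

@[simp]
theorem expVec_apply (u : Fin n →₀ ℕ) (i : Fin n) : expVec u i = u i := rfl

theorem expVec_injective : Function.Injective (expVec (n := n)) := fun u v h =>
  Finsupp.ext fun i => by simpa using congrFun h i

theorem exists_expVec_eq {h : Fin n → ℤ} (hh : 0 ≤ h) : ∃ c, expVec c = h :=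
  ⟨Finsupp.equivFunOnFinite.symm fun i => (h i).toNat, funext fun i => by simpa using hh i⟩

theorem expVec_nonneg (u : Fin n →₀ ℕ) : 0 ≤ expVec u := fun i => by simp

theorem expDiff_eq_sub (u v : Fin n →₀ ℕ) : expDiff u v = expVec u - expVec v := rfl

theorem expDiff_zero_right (u : Fin n →₀ ℕ) : expDiff u 0 = expVec u := by
  rw [expDiff_eq_sub, map_zero, sub_zero]

theorem expDiff_mem_comm {K : AddSubgroup (Fin n → ℤ)} {u v : Fin n →₀ ℕ} :
    expDiff u v ∈ K ↔ expDiff v u ∈ K :=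
  sub_mem_comm_iff

/-- The monoid `L⁺ = L ∩ ℕⁿ`, as a submonoid of the monoid of exponent vectors. -/
noncomputable def nonnegPart (L : AddSubgroup (Fin n → ℤ)) : AddSubmonoid (Fin n →₀ ℕ) :=
  L.toAddSubmonoid.comap expVec

theorem mem_nonnegPart {L : AddSubgroup (Fin n → ℤ)} {c : Fin n →₀ ℕ} :
    c ∈ nonnegPart L ↔ expVec c ∈ L := Iff.rfl

theorem expDiff_zero_right_mem_iff {L : AddSubgroup (Fin n → ℤ)} {c : Fin n →₀ ℕ} :
    expDiff c 0 ∈ L ↔ c ∈ nonnegPart L := by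
  rw [expDiff_zero_right, mem_nonnegPart]

theorem pureSublattice_eq_closure_image (L : AddSubgroup (Fin n → ℤ)) :
    pureSublattice L = AddSubgroup.closure (expVec '' (nonnegPart L : Set (Fin n →₀ ℕ))) := by
  refine congrArg AddSubgroup.closure (Set.ext fun h => ⟨fun hh => ?_, ?_⟩)
  · obtain ⟨c, rfl⟩ := exists_expVec_eq hh.2
    exact ⟨c, hh.1, rfl⟩
  · rintro ⟨c, hc, rfl⟩
    exact ⟨hc, expVec_nonneg c⟩

theorem expVec_mem_pureSublattice {L : AddSubgroup (Fin n → ℤ)} {c : Fin n →₀ ℕ} :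
    expVec c ∈ pureSublattice L ↔ c ∈ nonnegPart L := by
  refine ⟨fun h => ?_, fun h => AddSubgroup.subset_closure ⟨h, expVec_nonneg c⟩⟩
  exact (AddSubgroup.closure_le L).2 (fun _ hw => hw.1) h

/-- The set of coordinates at which some vector of `L⁺` is positive. The variables indexed by it
are those that are units modulo the lattice ideal. -/
def pureSupport (L : AddSubgroup (Fin n → ℤ)) : Set (Fin n) :=
  {i | ∃ c ∈ nonnegPart L, i ∈ c.support}

theorem support_subset_pureSupport {L : AddSubgroup (Fin n → ℤ)} {c : Fin n →₀ ℕ}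
    (hc : c ∈ nonnegPart L) : ↑c.support ⊆ pureSupport L :=
  fun _ hi => ⟨c, hc, hi⟩

theorem exists_nonnegPart_gt (L : AddSubgroup (Fin n → ℤ)) (m : ℕ) :
    ∃ w ∈ nonnegPart L, ∀ i ∈ pureSupport L, m < w i := by
  have h (i : Fin n) : ∃ c ∈ nonnegPart L, i ∈ pureSupport L → 0 < c i := by
    by_cases hi : i ∈ pureSupport L
    · obtain ⟨c, hc, hic⟩ := hi
      exact ⟨c, hc, fun _ => Nat.pos_of_ne_zero (Finsupp.mem_support_iff.1 hic)⟩
    · exact ⟨0, zero_mem _, fun h => absurd h hi⟩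
  choose c hc hpos using h
  refine ⟨(m + 1) • ∑ i, c i, nsmul_mem (sum_mem fun i _ => hc i) _, fun i hi => ?_⟩
  have hle : c i i ≤ (∑ j, c j) i := by
    rw [Finsupp.finsetSum_apply]
    exact Finset.single_le_sum (f := fun j => c j i) (fun _ _ => Nat.zero_le _)
      (Finset.mem_univ i)
  rw [Finsupp.smul_apply, smul_eq_mul]
  nlinarith [hpos i hi]

theorem exists_nonnegPart_ge (L : AddSubgroup (Fin n → ℤ)) (h : Fin n → ℤ) :
    ∃ w ∈ nonnegPart L, ∀ i ∈ pureSupport L, h i ≤ w i := by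
  obtain ⟨w, hw, hlt⟩ := exists_nonnegPart_gt L (Finset.univ.sup fun i => (h i).toNat)
  refine ⟨w, hw, fun i hi => ?_⟩
  have hle : (h i).toNat ≤ Finset.univ.sup fun i => (h i).toNat :=
    Finset.le_sup (f := fun i => (h i).toNat) (Finset.mem_univ i)
  have := hlt i hi
  omega

theorem mem_pureSublattice_iff {L : AddSubgroup (Fin n → ℤ)} {h : Fin n → ℤ} :
    h ∈ pureSublattice L ↔ h ∈ L ∧ ∀ i ∉ pureSupport L, h i = 0 := by
  constructor
  · intro hh
    rw [pureSublattice_eq_closure_image] at hh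
    obtain ⟨a, ha, b, hb, rfl⟩ := exists_sub_of_mem_closure_image _ _ hh
    refine ⟨sub_mem ha hb, fun i hi => ?_⟩
    have hzero {c : Fin n →₀ ℕ} (hc : c ∈ nonnegPart L) : c i = 0 :=
      Finsupp.notMem_support_iff.1 fun h => hi (support_subset_pureSupport hc h)
    simp [hzero ha, hzero hb]
  · rintro ⟨hh, h0⟩
    obtain ⟨w, hw, hle⟩ := exists_nonnegPart_ge L (-h)
    have hnonneg : 0 ≤ h + expVec w := by
      intro i
      by_cases hi : i ∈ pureSupport L
      · simpa [neg_le_iff_add_nonneg'] using hle i hi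
      · simp [h0 i hi]
    obtain ⟨c, hc⟩ := exists_expVec_eq hnonneg
    have hcL : c ∈ nonnegPart L := by
      rw [mem_nonnegPart, hc]
      exact add_mem hh hw
    rw [eq_sub_of_add_eq hc.symm]
    exact sub_mem (expVec_mem_pureSublattice.2 hcL) (expVec_mem_pureSublattice.2 hw)

theorem support_subset_of_expDiff_mem {L : AddSubgroup (Fin n → ℤ)} {u v : Fin n →₀ ℕ}
    (h : expDiff u v ∈ L) (hu : ↑u.support ⊆ pureSupport L) : ↑v.support ⊆ pureSupport L := by
  obtain ⟨w, hw, hle⟩ := exists_nonnegPart_ge L (expVec u)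
  have huw : u ≤ w := fun i => by
    by_cases hi : i ∈ pureSupport L
    · simpa using hle i hi
    · simp [Finsupp.notMem_support_iff.1 fun h => hi (hu h)]
  -- `w - u + v = w - (u - v)` lies in `L⁺`, and its support contains that of `v`.
  have hmem : w - u + v ∈ nonnegPart L := by
    have heq : expVec (w - u + v) = expVec w - expDiff u v := by
      ext i
      simp only [expVec_apply, Finsupp.coe_add, Finsupp.coe_tsub, Pi.add_apply, Pi.sub_apply,
        Nat.cast_add, Nat.cast_sub (huw i), expDiff]
      ring
    rw [mem_nonnegPart, heq]
    exact sub_mem hw h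
  exact (Finset.coe_subset.2 (Finsupp.support_mono (self_le_add_left v (w - u)))).trans
    (support_subset_pureSupport hmem)

theorem support_subset_iff_of_expDiff_mem {L : AddSubgroup (Fin n → ℤ)} {u v : Fin n →₀ ℕ}
    (h : expDiff u v ∈ L) : ↑u.support ⊆ pureSupport L ↔ ↑v.support ⊆ pureSupport L :=
  ⟨support_subset_of_expDiff_mem h, support_subset_of_expDiff_mem (expDiff_mem_comm.1 h)⟩

theorem expDiff_mem_pureSublattice {L : AddSubgroup (Fin n → ℤ)} {u v : Fin n →₀ ℕ}
    (h : expDiff u v ∈ L) (hu : ↑u.support ⊆ pureSupport L) : expDiff u v ∈ pureSublattice L := by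
  refine mem_pureSublattice_iff.2 ⟨h, fun i hi => ?_⟩
  have hui : u i = 0 := Finsupp.notMem_support_iff.1 (mt (@hu i) hi)
  have hvi : v i = 0 :=
    Finsupp.notMem_support_iff.1 (mt (@support_subset_of_expDiff_mem _ _ _ _ h hu i) hi)
  simp [expDiff, hui, hvi]

theorem pureSupport_nonempty {L : AddSubgroup (Fin n → ℤ)}
    (hr : latticeRank (pureSublattice L) ≠ 0) : (pureSupport L).Nonempty := by
  contrapose! hr
  have : Subsingleton (pureSublattice L) := by
    rw [(AddSubgroup.eq_bot_iff_forall (pureSublattice L)).2 fun h hh =>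
      funext fun i => (mem_pureSublattice_iff.1 hh).2 i (by simp [hr])]
    infer_instance
  exact Module.finrank_zero_of_subsingleton

theorem exists_nonnegPart_pos {L : AddSubgroup (Fin n → ℤ)}
    (hr : latticeRank (pureSublattice L) ≠ 0) :
    ∃ w ∈ nonnegPart L, w ≠ 0 ∧ ∀ i ∈ pureSupport L, 0 < w i := by
  obtain ⟨w, hw, hpos⟩ := exists_nonnegPart_gt L 0
  obtain ⟨i, hi⟩ := pureSupport_nonempty hr
  exact ⟨w, hw, fun h => by simpa [h] using hpos i hi, hpos⟩

end PureSublattice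

section PositiveBases

variable {n : ℕ} {L : AddSubgroup (Fin n → ℤ)}

/-- `C ⊆ ℕⁿ` is a `ℤ`-basis of `L_pure`. Linear independence is encoded by the bound on the
cardinality of the generating set `C`. -/
structure IsPositiveBasis (L : AddSubgroup (Fin n → ℤ)) (C : Set (Fin n →₀ ℕ)) : Prop where
  closure_image : AddSubgroup.closure (expVec '' C) = pureSublattice L
  encard_le : C.encard ≤ latticeRank (pureSublattice L)

theorem subset_nonnegPart_of_closure_image_eq {C : Set (Fin n →₀ ℕ)}
    (hC : AddSubgroup.closure (expVec '' C) = pureSublattice L) : C ⊆ nonnegPart L :=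
  fun _ hc => expVec_mem_pureSublattice.1
    (hC ▸ AddSubgroup.subset_closure (Set.mem_image_of_mem expVec hc))

theorem IsPositiveBasis.zero_notMem {C : Set (Fin n →₀ ℕ)} (hC : IsPositiveBasis L C) :
    0 ∉ C := by
  intro h0
  have hle : pureSublattice L ≤ AddSubgroup.closure (expVec '' (C \ {0})) := by
    rw [Set.image_sdiff expVec_injective, Set.image_singleton, map_zero,
      AddSubgroup.closure_sdiff_zero, hC.closure_image]
  have hfin : C.Finite := Set.finite_of_encard_le_coe hC.encard_le
  have hlt := hfin.sdiff.encard_lt_encard (Set.sdiff_singleton_ssubset.2 h0)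
  exact (hC.encard_le.trans (latticeRank_le_encard hle)).not_gt
    ((Set.encard_image_le _ _).trans_lt hlt)

theorem exists_isPositiveBasis_range {b : Fin (latticeRank (pureSublattice L)) → Fin n → ℤ}
    (hb : AddSubgroup.closure (Set.range b) = pureSublattice L) (hb0 : ∀ j, 0 ≤ b j) :
    ∃ c : Fin (latticeRank (pureSublattice L)) → Fin n →₀ ℕ,
      (∀ j, expVec (c j) = b j) ∧ IsPositiveBasis L (Set.range c) := by
  choose c hc using fun j => exists_expVec_eq (hb0 j)
  refine ⟨c, hc, ?_, ?_⟩
  · rwa [← Set.range_comp, show expVec ∘ c = b from funext hc]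
  · rw [← Set.image_univ]
    exact (Set.encard_image_le _ _).trans (by simp)

theorem exists_isPositiveBasis_gt (hr : 1 < latticeRank (pureSublattice L)) (m : ℕ) :
    ∃ C, IsPositiveBasis L C ∧ ∀ c ∈ C, ∀ i ∈ pureSupport L, m < c i := by
  obtain ⟨w, hw, hw0, hpos⟩ := exists_nonnegPart_pos (L := L) (by omega)
  obtain ⟨b, hb, hbm⟩ := exists_generators_gt_on hr (expVec_mem_pureSublattice.2 hw)
    ((map_ne_zero_iff expVec expVec_injective).2 hw0) (A := pureSupport L)
    (by simpa using hpos) m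
  have hb0 (j) : 0 ≤ b j := fun i => by
    by_cases hi : i ∈ pureSupport L
    · exact (Int.natCast_nonneg m).trans (hbm j i hi).le
    · have hbj : b j ∈ pureSublattice L := hb ▸ AddSubgroup.subset_closure ⟨j, rfl⟩
      exact ((mem_pureSublattice_iff.1 hbj).2 i hi).ge
  obtain ⟨c, hc, hC⟩ := exists_isPositiveBasis_range hb hb0
  refine ⟨_, hC, ?_⟩
  rintro _ ⟨j, rfl⟩ i hi
  simpa [← hc j] using hbm j i hi

theorem exists_isPositiveBasis_singleton (hr : latticeRank (pureSublattice L) = 1) :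
    ∃ w, IsPositiveBasis L {w} := by
  obtain ⟨c, hc, hc0, -⟩ := exists_nonnegPart_pos (L := L) (by omega)
  have hc' : expVec c ≠ 0 := (map_ne_zero_iff expVec expVec_injective).2 hc0
  obtain ⟨b, j, z, hb, hbc⟩ :=
    exists_generators_eq_zsmul (expVec_mem_pureSublattice.2 hc) hc'
  obtain ⟨g, hg, hg0⟩ : ∃ g, AddSubgroup.closure {g} = pureSublattice L ∧ 0 ≤ g := by
    have : Unique (Fin (latticeRank (pureSublattice L))) := by rw [hr]; infer_instance
    rw [Set.range_unique, ← Unique.eq_default j] at hb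
    have hzb : 0 ≤ z • b j := hbc ▸ expVec_nonneg c
    rcases lt_trichotomy z 0 with hz | rfl | hz
    · refine ⟨-b j, by rw [← Set.neg_singleton, AddSubgroup.closure_neg, hb], ?_⟩
      rwa [← neg_smul_neg, smul_nonneg_iff_nonneg_of_pos_left (neg_pos.2 hz)] at hzb
    · exact absurd (by rw [hbc, zero_smul]) hc'
    · exact ⟨b j, hb, (smul_nonneg_iff_nonneg_of_pos_left hz).1 hzb⟩
  obtain ⟨w, rfl⟩ := exists_expVec_eq hg0
  exact ⟨w, by rwa [Set.image_singleton], by simp [hr]⟩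

end PositiveBases

section MarkovBases

variable {k : Type*} [Field k] {n : ℕ} {I : Ideal (MvPolynomial (Fin n) k)}
  {S T : Set (MvPolynomial (Fin n) k)}

/-- `S` is a system of binomial generators of `I`, not necessarily a minimal one. -/
structure IsBinomialGeneratingSet (I : Ideal (MvPolynomial (Fin n) k))
    (S : Set (MvPolynomial (Fin n) k)) : Prop where
  isBinomial : ∀ B ∈ S, IsBinomial B
  span_eq : Ideal.span S = I

theorem IsBinomialGeneratingSet.mem (hS : IsBinomialGeneratingSet I S)
    {B : MvPolynomial (Fin n) k} (hB : B ∈ S) : B ∈ I :=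
  hS.span_eq ▸ Ideal.subset_span hB

theorem IsMinimalBinomialGeneratingSet.isBinomialGeneratingSet
    (hS : IsMinimalBinomialGeneratingSet I S) : IsBinomialGeneratingSet I S :=
  ⟨hS.1, hS.2.1⟩

theorem IsMarkovBasis.isBinomialGeneratingSet (hS : IsMarkovBasis I S) :
    IsBinomialGeneratingSet I S :=
  hS.1.isBinomialGeneratingSet

theorem IsBinomialGeneratingSet.exists_minimal_subset (hS : IsBinomialGeneratingSet I S) :
    ∃ T ⊆ S, T.Finite ∧ IsMinimalBinomialGeneratingSet I T := by
  obtain ⟨F, hFS, hF⟩ := (Submodule.fg_span_iff_fg_span_finset_subset S).1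
    (IsNoetherian.noetherian (Ideal.span S))
  have hfin : {T | T ⊆ (F : Set (MvPolynomial (Fin n) k)) ∧ Ideal.span T = I}.Finite :=
    F.finite_toSet.finite_subsets.subset fun _ hT => hT.1
  have hFI : Ideal.span (F : Set (MvPolynomial (Fin n) k)) = I := hF.symm.trans hS.span_eq
  obtain ⟨T, hTF, hT⟩ := hfin.exists_le_minimal ⟨subset_rfl, hFI⟩
  refine ⟨T, hTF.trans hFS, F.finite_toSet.subset hTF,
    fun B hB => hS.isBinomial B (hFS (hTF hB)), hT.prop.2, fun T' hT' hspan => ?_⟩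
  exact hT'.not_subset (hT.le_of_le ⟨hT'.subset.trans hTF, hspan⟩ hT'.subset)

theorem IsBinomialGeneratingSet.exists_isMarkovBasis (hS : IsBinomialGeneratingSet I S) :
    ∃ T, IsMarkovBasis I T := by
  obtain ⟨S₀, -, -, hS₀⟩ := hS.exists_minimal_subset
  obtain ⟨T, hT, hmin⟩ := exists_minimalFor_of_wellFoundedLT
    (IsMinimalBinomialGeneratingSet I) Set.encard ⟨S₀, hS₀⟩
  exact ⟨T, hT, fun T' hT' => (le_total T.encard T'.encard).elim id (hmin hT')⟩

theorem IsMarkovBasis.encard_le (hS : IsMarkovBasis I S) (hT : IsBinomialGeneratingSet I T) :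
    S.encard ≤ T.encard := by
  obtain ⟨T', hT'T, -, hT'⟩ := hT.exists_minimal_subset
  exact (hS.2 T' hT').trans (Set.encard_le_encard hT'T)

theorem IsMarkovBasis.finite (hS : IsMarkovBasis I S) : S.Finite := by
  obtain ⟨T, -, hfin, hT⟩ := hS.isBinomialGeneratingSet.exists_minimal_subset
  exact hfin.finite_of_encard_le (hS.2 T hT)

theorem IsMarkovBasis.of_encard_le (hS : IsMarkovBasis I S) (hT : IsBinomialGeneratingSet I T)
    (hle : T.encard ≤ S.encard) : IsMarkovBasis I T := by
  refine ⟨⟨hT.isBinomial, hT.span_eq, fun T' hT' hspan => ?_⟩,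
    fun T' hT' => hle.trans (hS.2 T' hT')⟩
  have hT'gen : IsBinomialGeneratingSet I T' :=
    ⟨fun B hB => hT.isBinomial B (hT'.subset hB), hspan⟩
  have hfin : T.Finite := hS.finite.finite_of_encard_le hle
  exact ((hfin.subset hT'.subset).encard_lt_encard hT').not_ge (hle.trans (hS.encard_le hT'gen))

theorem IsIndispensableBinomial.isIndispensableMonomial {B : MvPolynomial (Fin n) k}
    (hB : IsIndispensableBinomial I B) {u : Fin n →₀ ℕ} (hu : u ∈ B.support) :
    IsIndispensableMonomial I u := by
  intro S hS
  obtain ⟨c, hc, hcB⟩ := hB.2 S hS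
  exact ⟨c • B, hcB, by rwa [support_smul_eq hc]⟩

end MarkovBases

section Binomials

variable {k : Type*} [Field k] {n : ℕ} {L : AddSubgroup (Fin n → ℤ)} {u v : Fin n →₀ ℕ}

theorem isBinomial_smul_sub (huv : u ≠ v) {a : k} (ha : a ≠ 0) :
    IsBinomial (a • (monomial u (1 : k) - monomial v 1)) :=
  ⟨u, v, a, -a, huv, ha, neg_ne_zero.2 ha, by simp [smul_monomial, sub_eq_add_neg]⟩

theorem isBinomial_sub (huv : u ≠ v) : IsBinomial (monomial u (1 : k) - monomial v 1) := by
  simpa using isBinomial_smul_sub huv (one_ne_zero (α := k))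

theorem support_smul_sub (huv : u ≠ v) {a : k} (ha : a ≠ 0) :
    (a • (monomial u (1 : k) - monomial v 1)).support = {u, v} := by
  ext t
  rw [mem_support_iff, coeff_smul, coeff_sub, coeff_monomial, coeff_monomial]
  by_cases h1 : u = t <;> by_cases h2 : v = t <;> simp_all [eq_comm]

theorem support_sub_monomial (huv : u ≠ v) :
    (monomial u (1 : k) - monomial v 1).support = {u, v} := by
  simpa using support_smul_sub huv (one_ne_zero (α := k))

theorem monomial_sub_mem_latticeIdeal (h : expDiff u v ∈ L) :
    monomial u (1 : k) - monomial v 1 ∈ latticeIdeal k L :=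
  Ideal.subset_span ⟨u, v, h, rfl⟩

open Classical in
/-- The homomorphism from `k[x₁, …, xₙ]` to the group algebra of `ℤⁿ / K` that sends `x_i` to the
class of the `i`-th unit vector for `i ∈ A` and to `0` for `i ∉ A`. -/
noncomputable def classHom (k : Type*) [Field k] {n : ℕ} (A : Set (Fin n))
    (K : AddSubgroup (Fin n → ℤ)) :
    MvPolynomial (Fin n) k →ₐ[k] AddMonoidAlgebra k ((Fin n → ℤ) ⧸ K) :=
  AddMonoidAlgebra.lift k _ _
    { toFun u := if ↑u.toAdd.support ⊆ A then
        AddMonoidAlgebra.single (QuotientAddGroup.mk (expVec u.toAdd)) 1 else 0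
      map_one' := by simp [AddMonoidAlgebra.one_def]
      map_mul' u v := by
        have hsupp : (u.toAdd + v.toAdd).support = u.toAdd.support ∪ v.toAdd.support := by
          ext i
          simp [or_iff_not_imp_left]
        by_cases hu : ↑u.toAdd.support ⊆ A <;> by_cases hv : ↑v.toAdd.support ⊆ A <;>
          simp [hsupp, hu, hv, AddMonoidAlgebra.single_mul_single] }

open Classical in
theorem classHom_monomial (A : Set (Fin n)) (K : AddSubgroup (Fin n → ℤ)) (u : Fin n →₀ ℕ)
    (a : k) : classHom k A K (monomial u a) =
      if ↑u.support ⊆ A then AddMonoidAlgebra.single (QuotientAddGroup.mk (expVec u)) a else 0 := by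
  rw [classHom, monomial, AddMonoidAlgebra.lsingle_apply]
  simp [AddMonoidAlgebra.lift_single]

theorem mk_expVec_eq_iff {K : AddSubgroup (Fin n → ℤ)} :
    (QuotientAddGroup.mk (expVec u) : (Fin n → ℤ) ⧸ K) = QuotientAddGroup.mk (expVec v) ↔
      expDiff u v ∈ K :=
  QuotientAddGroup.eq_iff_sub_mem

theorem sub_mem_ker_classHom {A : Set (Fin n)} {K : AddSubgroup (Fin n → ℤ)}
    (hsupp : ↑u.support ⊆ A ↔ ↑v.support ⊆ A) (hK : ↑u.support ⊆ A → expDiff u v ∈ K) :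
    monomial u 1 - monomial v 1 ∈ RingHom.ker (classHom k A K) := by
  rw [RingHom.mem_ker, map_sub, classHom_monomial, classHom_monomial]
  by_cases hu : ↑u.support ⊆ A
  · rw [if_pos hu, if_pos (hsupp.1 hu), mk_expVec_eq_iff.2 (hK hu), sub_self]
  · rw [if_neg hu, if_neg (mt hsupp.2 hu), sub_self]

theorem expDiff_mem_of_classHom_eq_zero {A : Set (Fin n)} {K : AddSubgroup (Fin n → ℤ)}
    (hu : ↑u.support ⊆ A) (hv : ↑v.support ⊆ A) {a b : k} (ha : a ≠ 0)
    (h : classHom k A K (monomial u a + monomial v b) = 0) : expDiff u v ∈ K ∧ b = -a := by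
  rw [map_add, classHom_monomial, classHom_monomial, if_pos hu, if_pos hv] at h
  by_cases huv : expDiff u v ∈ K
  · rw [mk_expVec_eq_iff.2 huv, ← AddMonoidAlgebra.single_add,
      AddMonoidAlgebra.single_eq_zero] at h
    exact ⟨huv, (neg_eq_of_add_eq_zero_right h).symm⟩
  · have hcoeff := congrArg (fun f => f.coeff (QuotientAddGroup.mk (expVec u))) h
    have hne := mt mk_expVec_eq_iff.1 huv
    simp [Ne.symm hne, ha] at hcoeff

theorem latticeIdeal_le_ker_classHom (L : AddSubgroup (Fin n → ℤ)) :
    latticeIdeal k L ≤ RingHom.ker (classHom k Set.univ L) := by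
  rw [latticeIdeal, Ideal.span_le]
  rintro _ ⟨u, v, h, rfl⟩
  exact sub_mem_ker_classHom (by simp) fun _ => h

theorem IsBinomial.exists_eq_smul {B : MvPolynomial (Fin n) k} (hB : IsBinomial B)
    (hmem : B ∈ latticeIdeal k L) : ∃ (u v : Fin n →₀ ℕ) (a : k), u ≠ v ∧ a ≠ 0 ∧
      expDiff u v ∈ L ∧ B = a • (monomial u 1 - monomial v 1) := by
  obtain ⟨u, v, a, b, huv, ha, -, rfl⟩ := hB
  obtain ⟨h, rfl⟩ := expDiff_mem_of_classHom_eq_zero (by simp) (by simp) ha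
    (latticeIdeal_le_ker_classHom L hmem)
  exact ⟨u, v, a, huv, ha, h, by simp [smul_monomial, sub_eq_add_neg]⟩

theorem exists_eq_smul_of_mem_support {B : MvPolynomial (Fin n) k} (hB : IsBinomial B)
    (hmem : B ∈ latticeIdeal k L) (hv : v ∈ B.support) : ∃ (u : Fin n →₀ ℕ) (a : k),
      u ≠ v ∧ a ≠ 0 ∧ expDiff u v ∈ L ∧ B = a • (monomial u 1 - monomial v 1) := by
  obtain ⟨s, t, a, hst, ha, hL, rfl⟩ := hB.exists_eq_smul hmem
  rw [support_smul_sub hst ha, Finset.mem_insert, Finset.mem_singleton] at hv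
  rcases hv with rfl | rfl
  · exact ⟨t, -a, hst.symm, neg_ne_zero.2 ha, expDiff_mem_comm.1 hL, by
      rw [neg_smul, ← smul_neg, neg_sub]⟩
  · exact ⟨s, a, hst, ha, hL, rfl⟩

variable (k L) in
theorem exists_isBinomialGeneratingSet_latticeIdeal :
    ∃ S, IsBinomialGeneratingSet (latticeIdeal k L) S := by
  refine ⟨{f | ∃ u v : Fin n →₀ ℕ, expDiff u v ∈ L ∧ f = monomial u 1 - monomial v 1} \ {0},
    ?_, Ideal.span_sdiff_singleton_zero⟩
  rintro _ ⟨⟨u, v, -, rfl⟩, h0⟩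
  refine isBinomial_sub ?_
  rintro rfl
  simp at h0

end Binomials

section PurePart

variable {k : Type*} [Field k] {n : ℕ} {L : AddSubgroup (Fin n → ℤ)} {u v : Fin n →₀ ℕ}
  {S : Set (MvPolynomial (Fin n) k)}

/-- The elements of `S` all of whose variables are units modulo `I_L`. -/
def purePart (L : AddSubgroup (Fin n → ℤ)) (S : Set (MvPolynomial (Fin n) k)) :
    Set (MvPolynomial (Fin n) k) :=
  {B ∈ S | ∀ u ∈ B.support, ↑u.support ⊆ pureSupport L}

theorem purePart_subset : purePart L S ⊆ S := fun _ h => h.1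

theorem mem_purePart_of_mem_support (hS : IsBinomialGeneratingSet (latticeIdeal k L) S)
    {B : MvPolynomial (Fin n) k} (hB : B ∈ S) (hu : u ∈ B.support)
    (hsupp : ↑u.support ⊆ pureSupport L) : B ∈ purePart L S := by
  refine ⟨hB, ?_⟩
  obtain ⟨v, a, hvu, ha, hL, rfl⟩ :=
    exists_eq_smul_of_mem_support (hS.isBinomial B hB) (hS.mem hB) hu
  simp only [support_smul_sub hvu ha, Finset.mem_insert, Finset.mem_singleton, forall_eq_or_imp,
    forall_eq]
  exact ⟨(support_subset_iff_of_expDiff_mem hL).2 hsupp, hsupp⟩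

theorem pureSublattice_le_of_purePart_subset_ker
    (hS : IsBinomialGeneratingSet (latticeIdeal k L) S) {K : AddSubgroup (Fin n → ℤ)}
    (hK : purePart L S ⊆ RingHom.ker (classHom k (pureSupport L) K)) :
    pureSublattice L ≤ K := by
  have hker : latticeIdeal k L ≤ RingHom.ker (classHom k (pureSupport L) K) := by
    rw [← hS.span_eq, Ideal.span_le]
    intro B hB
    by_cases hpure : B ∈ purePart L S
    · exact hK hpure
    · obtain ⟨u, v, a, huv, ha, hL, rfl⟩ := (hS.isBinomial B hB).exists_eq_smul (hS.mem hB)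
      have hu : u ∈ (a • (monomial u (1 : k) - monomial v 1)).support := by
        simp [support_smul_sub huv ha]
      exact Submodule.smul_of_tower_mem _ a <|
        sub_mem_ker_classHom (support_subset_iff_of_expDiff_mem hL) fun h =>
          absurd (mem_purePart_of_mem_support hS hB hu h) hpure
  rw [pureSublattice_eq_closure_image, AddSubgroup.closure_le]
  rintro _ ⟨c, hc, rfl⟩
  rw [← expDiff_zero_right]
  have hmem := hker (monomial_sub_mem_latticeIdeal (expDiff_zero_right_mem_iff.2 hc))
  rw [RingHom.mem_ker, sub_eq_add_neg, ← map_neg] at hmem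
  exact (expDiff_mem_of_classHom_eq_zero (support_subset_pureSupport hc) (by simp) one_ne_zero
    hmem).1

theorem latticeRank_le_encard_purePart (hS : IsBinomialGeneratingSet (latticeIdeal k L) S) :
    (latticeRank (pureSublattice L) : ℕ∞) ≤ (purePart L S).encard := by
  choose u v a _ _ hL hB using fun B : purePart L S =>
    (hS.isBinomial B (purePart_subset B.2)).exists_eq_smul (hS.mem (purePart_subset B.2))
  let g : purePart L S → Fin n → ℤ := fun B => expDiff (u B) (v B)
  have hle : pureSublattice L ≤ AddSubgroup.closure (Set.range g) := by
    refine pureSublattice_le_of_purePart_subset_ker hS fun B hBp => ?_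
    rw [SetLike.mem_coe, show B = _ from hB ⟨B, hBp⟩]
    exact Submodule.smul_of_tower_mem _ _ <|
      sub_mem_ker_classHom (support_subset_iff_of_expDiff_mem (hL _)) fun _ =>
        AddSubgroup.subset_closure ⟨_, rfl⟩
  calc (latticeRank (pureSublattice L) : ℕ∞) ≤ (Set.range g).encard := latticeRank_le_encard hle
    _ ≤ (Set.univ : Set (purePart L S)).encard := by
      rw [← Set.image_univ]
      exact Set.encard_image_le _ _
    _ = (purePart L S).encard := by rw [Set.encard_univ, Set.encard]

/-- The exponents of the monomials that are congruent to `1` modulo `J`. -/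
def unitExponents (J : Ideal (MvPolynomial (Fin n) k)) : AddSubmonoid (Fin n →₀ ℕ) where
  carrier := {a | monomial a 1 - 1 ∈ J}
  zero_mem' := by simp
  add_mem' {a b} ha hb := by
    have h : monomial (a + b) (1 : k) - 1 =
        monomial a 1 * (monomial b 1 - 1) + (monomial a 1 - 1) := by
      rw [mul_sub, monomial_mul, mul_one, mul_one, sub_add_sub_cancel]
    rw [Set.mem_ofPred_eq, h]
    exact J.add_mem (J.mul_mem_left _ hb) ha

theorem monomial_sub_mem_of_expDiff_mem_closure {J : Ideal (MvPolynomial (Fin n) k)}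
    {C : Set (Fin n →₀ ℕ)} (hC : C ⊆ unitExponents J)
    (h : expDiff u v ∈ AddSubgroup.closure (expVec '' C)) :
    monomial u (1 : k) - monomial v 1 ∈ J := by
  obtain ⟨a, ha, b, hb, hab⟩ := exists_sub_of_mem_closure_image expVec (unitExponents J)
    (AddSubgroup.closure_mono (Set.image_mono hC) h)
  have hadd : u + b = v + a := expVec_injective <| by
    rw [map_add, map_add, add_comm (expVec v), ← sub_eq_sub_iff_add_eq_add, ← hab, expDiff_eq_sub]
  have heq : monomial u (1 : k) - monomial v 1 =
      monomial v 1 * (monomial a 1 - 1) - monomial u 1 * (monomial b 1 - 1) := by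
    rw [mul_sub, mul_sub, monomial_mul, monomial_mul, hadd]
    ring
  exact heq ▸ J.sub_mem (J.mul_mem_left _ ha) (J.mul_mem_left _ hb)

/-- The system obtained from `S` by replacing its pure part with the binomials `x^c - 1`, `c ∈ C`,
and multiplying the other elements by `x^d`. -/
def replacePurePart (L : AddSubgroup (Fin n → ℤ)) (C : Set (Fin n →₀ ℕ)) (d : Fin n →₀ ℕ)
    (S : Set (MvPolynomial (Fin n) k)) : Set (MvPolynomial (Fin n) k) :=
  (fun c => monomial c 1 - monomial 0 1) '' C ∪ (monomial d 1 * ·) '' (S \ purePart L S)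

theorem encard_replacePurePart_le (L : AddSubgroup (Fin n → ℤ)) (C : Set (Fin n →₀ ℕ))
    (d : Fin n →₀ ℕ) (S : Set (MvPolynomial (Fin n) k)) :
    (replacePurePart L C d S).encard ≤ C.encard + (S \ purePart L S).encard :=
  (Set.encard_union_le _ _).trans (add_le_add (Set.encard_image_le _ _) (Set.encard_image_le _ _))

variable {C : Set (Fin n →₀ ℕ)} {d : Fin n →₀ ℕ}

theorem isBinomial_of_mem_replacePurePart (hS : IsBinomialGeneratingSet (latticeIdeal k L) S)
    (hC : 0 ∉ C) : ∀ B ∈ replacePurePart L C d S, IsBinomial B := by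
  rintro _ (⟨c, hc, rfl⟩ | ⟨B, hB, rfl⟩)
  · exact isBinomial_sub (ne_of_mem_of_not_mem hc hC)
  · obtain ⟨u, v, a, huv, ha, -, rfl⟩ := (hS.isBinomial B hB.1).exists_eq_smul (hS.mem hB.1)
    simp only [mul_smul_comm, mul_sub, monomial_mul, one_mul]
    exact isBinomial_smul_sub ((add_right_injective d).ne huv) ha

theorem span_replacePurePart (hS : IsBinomialGeneratingSet (latticeIdeal k L) S)
    (hC : AddSubgroup.closure (expVec '' C) = pureSublattice L) (hd : d ∈ nonnegPart L) :
    Ideal.span (replacePurePart L C d S) = latticeIdeal k L := by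
  set T := replacePurePart L C d S
  have hpure {u v : Fin n →₀ ℕ} (h : expDiff u v ∈ pureSublattice L) :
      monomial u (1 : k) - monomial v 1 ∈ Ideal.span T :=
    monomial_sub_mem_of_expDiff_mem_closure
      (fun c hc => Ideal.subset_span (Or.inl ⟨c, hc, rfl⟩)) (hC ▸ h)
  refine le_antisymm (Ideal.span_le.2 ?_) (hS.span_eq.ge.trans (Ideal.span_le.2 ?_))
  · rintro _ (⟨c, hc, rfl⟩ | ⟨B, hB, rfl⟩)
    · exact monomial_sub_mem_latticeIdeal
        (expDiff_zero_right_mem_iff.2 (subset_nonnegPart_of_closure_image_eq hC hc))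
    · exact Ideal.mul_mem_left _ _ (hS.mem hB.1)
  · intro B hB
    by_cases hBp : B ∈ purePart L S
    · obtain ⟨u, v, a, huv, ha, hL, rfl⟩ := (hS.isBinomial B hB).exists_eq_smul (hS.mem hB)
      have hu : ↑u.support ⊆ pureSupport L := hBp.2 u (by simp [support_smul_sub huv ha])
      exact Submodule.smul_of_tower_mem _ a (hpure (expDiff_mem_pureSublattice hL hu))
    · have hd1 : monomial d (1 : k) - monomial 0 1 ∈ Ideal.span T :=
        hpure ((expDiff_zero_right d).symm ▸ expVec_mem_pureSublattice.2 hd)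
      have hdB : monomial d 1 * B ∈ Ideal.span T :=
        Ideal.subset_span (Or.inr ⟨B, ⟨hB, hBp⟩, rfl⟩)
      rw [SetLike.mem_coe, show B = monomial d 1 * B - B * (monomial d 1 - monomial 0 1) by
        rw [show monomial (0 : Fin n →₀ ℕ) (1 : k) = 1 from rfl]; ring]
      exact Ideal.sub_mem _ hdB (Ideal.mul_mem_left _ _ hd1)

theorem IsBinomialGeneratingSet.replacePurePart
    (hS : IsBinomialGeneratingSet (latticeIdeal k L) S) (hC : IsPositiveBasis L C)
    (hd : d ∈ nonnegPart L) :
    IsBinomialGeneratingSet (latticeIdeal k L) (replacePurePart L C d S) :=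
  ⟨isBinomial_of_mem_replacePurePart hS hC.zero_notMem,
    span_replacePurePart hS hC.closure_image hd⟩

theorem IsMarkovBasis.encard_purePart (hS : IsMarkovBasis (latticeIdeal k L) S)
    (hC : IsPositiveBasis L C) : (purePart L S).encard = C.encard := by
  refine le_antisymm ?_
    (hC.encard_le.trans (latticeRank_le_encard_purePart hS.isBinomialGeneratingSet))
  have hgen := hS.isBinomialGeneratingSet.replacePurePart hC (zero_mem _)
  have hle := (hS.encard_le hgen).trans (encard_replacePurePart_le L C 0 S)
  rw [← Set.encard_sdiff_add_encard_of_subset (purePart_subset (L := L) (S := S)), add_comm] at hle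
  exact (ENat.add_le_add_iff_right
    (Set.encard_ne_top_iff.2 (hS.finite.subset Set.sdiff_subset))).1 hle

theorem IsMarkovBasis.replacePurePart (hS : IsMarkovBasis (latticeIdeal k L) S)
    (hC : IsPositiveBasis L C) (hd : d ∈ nonnegPart L) :
    IsMarkovBasis (latticeIdeal k L) (replacePurePart L C d S) := by
  refine hS.of_encard_le (hS.isBinomialGeneratingSet.replacePurePart hC hd)
    ((encard_replacePurePart_le L C d S).trans ?_)
  rw [← hS.encard_purePart hC, add_comm, Set.encard_sdiff_add_encard_of_subset purePart_subset]

end PurePart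

section Indispensable

variable {k : Type*} [Field k] {n : ℕ} {L : AddSubgroup (Fin n → ℤ)} {u w : Fin n →₀ ℕ}
  {B : MvPolynomial (Fin n) k}

theorem isIndispensableMonomial_zero (hL : (pureSupport L).Nonempty) :
    IsIndispensableMonomial (latticeIdeal k L) 0 := by
  intro S hS
  by_contra! hno
  obtain ⟨i, c, hc, hi⟩ := hL
  have hc0 : c ≠ 0 := Finsupp.support_nonempty_iff.1 ⟨i, hi⟩
  have hle : latticeIdeal k L ≤ RingHom.ker (constantCoeff (R := k) (σ := Fin n)) := by
    rw [← hS.isBinomialGeneratingSet.span_eq, Ideal.span_le]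
    exact fun B hB => notMem_support_iff.1 (hno B hB)
  have h := hle (monomial_sub_mem_latticeIdeal (expDiff_zero_right_mem_iff.2 hc))
  rw [RingHom.mem_ker, map_sub, constantCoeff_monomial, constantCoeff_monomial, if_neg hc0] at h
  simp at h

theorem not_isIndispensableMonomial {C : Set (Fin n →₀ ℕ)} (hC : IsPositiveBasis L C)
    (hL : (pureSupport L).Nonempty) (hu0 : u ≠ 0) (huC : u ∉ C) :
    ¬ IsIndispensableMonomial (latticeIdeal k L) u := by
  intro hu
  obtain ⟨i, hi⟩ := hL
  obtain ⟨d, hd, hdu⟩ := exists_nonnegPart_gt L (u i)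
  obtain ⟨_, hS₀⟩ := exists_isBinomialGeneratingSet_latticeIdeal k L
  obtain ⟨S, hS⟩ := hS₀.exists_isMarkovBasis
  obtain ⟨_, ⟨c, hc, rfl⟩ | ⟨B, -, rfl⟩, huB⟩ := hu _ (hS.replacePurePart hC hd)
  · rw [support_sub_monomial (ne_of_mem_of_not_mem hc hC.zero_notMem), Finset.mem_insert,
      Finset.mem_singleton] at huB
    exact huB.elim (fun h => huC (h ▸ hc)) hu0
  · have hle : d ≤ u := by
      by_contra h
      simp [mem_support_iff, coeff_monomial_mul', h] at huB
    exact (hdu i hi).not_ge (hle i)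

theorem isIndispensableMonomial_iff_of_one_lt_rank (hr : 1 < latticeRank (pureSublattice L)) :
    IsIndispensableMonomial (latticeIdeal k L) u ↔ u = 0 := by
  have hL : (pureSupport L).Nonempty := pureSupport_nonempty (by omega)
  refine ⟨fun hu => ?_, fun h => h ▸ isIndispensableMonomial_zero hL⟩
  by_contra hu0
  obtain ⟨i, hi⟩ := id hL
  obtain ⟨C, hC, hCu⟩ := exists_isPositiveBasis_gt hr (u i)
  exact not_isIndispensableMonomial hC hL hu0 (fun h => (hCu u h i hi).false) hu

theorem IsIndispensableBinomial.mem_latticeIdeal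
    (hB : IsIndispensableBinomial (latticeIdeal k L) B) : B ∈ latticeIdeal k L := by
  obtain ⟨_, hS₀⟩ := exists_isBinomialGeneratingSet_latticeIdeal k L
  obtain ⟨S, hS⟩ := hS₀.exists_isMarkovBasis
  obtain ⟨c, hc, hcB⟩ := hB.2 S hS
  rw [← inv_smul_smul₀ hc B]
  exact Submodule.smul_of_tower_mem _ c⁻¹ (hS.isBinomialGeneratingSet.mem hcB)

theorem IsIndispensableBinomial.exists_eq_smul
    (hB : IsIndispensableBinomial (latticeIdeal k L) B) :
    ∃ (u v : Fin n →₀ ℕ) (a : k), u ≠ v ∧ a ≠ 0 ∧ B = a • (monomial u 1 - monomial v 1) ∧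
      IsIndispensableMonomial (latticeIdeal k L) u ∧
      IsIndispensableMonomial (latticeIdeal k L) v := by
  obtain ⟨u, v, a, huv, ha, -, rfl⟩ := hB.1.exists_eq_smul hB.mem_latticeIdeal
  have hsupp := support_smul_sub huv ha
  exact ⟨u, v, a, huv, ha, rfl, hB.isIndispensableMonomial (by simp [hsupp]),
    hB.isIndispensableMonomial (by simp [hsupp])⟩

theorem not_isIndispensableBinomial_of_one_lt_rank
    (hr : 1 < latticeRank (pureSublattice L)) :
    ¬ IsIndispensableBinomial (latticeIdeal k L) B := by
  intro hB
  obtain ⟨u, v, a, huv, -, -, hu, hv⟩ := hB.exists_eq_smul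
  rw [isIndispensableMonomial_iff_of_one_lt_rank hr] at hu hv
  exact huv (hu.trans hv.symm)

theorem eq_of_closure_singleton_expVec_eq (hu : u ≠ 0)
    (h : AddSubgroup.closure {expVec u} = AddSubgroup.closure {expVec w}) : u = w := by
  rw [← AddSubgroup.zmultiples_eq_closure, ← AddSubgroup.zmultiples_eq_closure,
    AddSubgroup.zmultiples_eq_zmultiples_iff (not_isOfFinAddOrder_of_isAddTorsionFree
      ((map_ne_zero_iff expVec expVec_injective).2 hu))] at h
  rcases h with h | h
  · exact expVec_injective h
  · have hu' : expVec u ≤ 0 := neg_nonneg.1 (h ▸ expVec_nonneg w)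
    exact absurd (expVec_injective (hu'.antisymm (expVec_nonneg u))) hu

theorem IsPositiveBasis.pureSupport_nonempty (hw : IsPositiveBasis L {w}) :
    (pureSupport L).Nonempty := by
  have hw0 : w ≠ 0 := fun h => hw.zero_notMem h.symm
  exact (Finset.coe_nonempty.2 (Finsupp.support_nonempty_iff.2 hw0)).mono
    (support_subset_pureSupport (subset_nonnegPart_of_closure_image_eq hw.closure_image rfl))

theorem isIndispensableBinomial_sub (hw : IsPositiveBasis L {w}) :
    IsIndispensableBinomial (latticeIdeal k L) (monomial w 1 - monomial 0 1) := by
  have hw0 : w ≠ 0 := fun h => hw.zero_notMem h.symm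
  refine ⟨isBinomial_sub hw0, fun S hS => ?_⟩
  have hgen := hS.isBinomialGeneratingSet
  obtain ⟨B, hBS, h0⟩ := isIndispensableMonomial_zero hw.pureSupport_nonempty S hS
  have hBpure : B ∈ purePart L S := mem_purePart_of_mem_support hgen hBS h0 (by simp)
  obtain ⟨B', hB'⟩ := Set.encard_eq_one.1
    ((hS.encard_purePart hw).trans (Set.encard_singleton w))
  obtain rfl : B = B' := by simpa [hB'] using hBpure
  obtain ⟨c, a, -, ha, hcL, rfl⟩ :=
    exists_eq_smul_of_mem_support (hgen.isBinomial B hBS) (hgen.mem hBS) h0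
  have hle : pureSublattice L ≤ AddSubgroup.closure {expVec c} := by
    refine pureSublattice_le_of_purePart_subset_ker hgen ?_
    rw [hB', Set.singleton_subset_iff]
    refine Submodule.smul_of_tower_mem _ a
      (sub_mem_ker_classHom (support_subset_iff_of_expDiff_mem hcL) fun _ => ?_)
    rw [expDiff_zero_right]
    exact AddSubgroup.subset_closure rfl
  have hcpure : expVec c ∈ pureSublattice L :=
    expVec_mem_pureSublattice.2 (expDiff_zero_right_mem_iff.1 hcL)
  have hclosure : AddSubgroup.closure {expVec w} = AddSubgroup.closure {expVec c} := by
    rw [← Set.image_singleton, hw.closure_image]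
    exact hle.antisymm ((AddSubgroup.closure_le _).2 (Set.singleton_subset_iff.2 hcpure))
  obtain rfl := eq_of_closure_singleton_expVec_eq hw0 hclosure
  exact ⟨a, ha, hBS⟩

theorem isIndispensableMonomial_iff (hw : IsPositiveBasis L {w}) :
    IsIndispensableMonomial (latticeIdeal k L) u ↔ u = 0 ∨ u = w := by
  constructor
  · contrapose!
    exact fun h => not_isIndispensableMonomial hw hw.pureSupport_nonempty h.1 h.2
  · rintro (rfl | rfl)
    · exact isIndispensableMonomial_zero hw.pureSupport_nonempty
    · refine (isIndispensableBinomial_sub hw).isIndispensableMonomial ?_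
      rw [support_sub_monomial fun h => hw.zero_notMem h.symm]
      exact Finset.mem_insert_self u {0}

theorem IsIndispensableBinomial.exists_eq_smul_sub
    (hB : IsIndispensableBinomial (latticeIdeal k L) B) (hw : IsPositiveBasis L {w}) :
    ∃ c : k, c ≠ 0 ∧ B = c • (monomial w 1 - monomial 0 1) := by
  obtain ⟨u, v, a, huv, ha, rfl, hu, hv⟩ := hB.exists_eq_smul
  rw [isIndispensableMonomial_iff hw] at hu hv
  rcases hu with rfl | rfl <;> rcases hv with rfl | rfl
  · exact absurd rfl huv
  · exact ⟨-a, neg_ne_zero.2 ha, by rw [neg_smul, ← smul_neg, neg_sub]⟩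
  · exact ⟨a, ha, rfl⟩
  · exact absurd rfl huv

end Indispensable

end LatticeIdeal

theorem theorem4p15 {k : Type*} [Field k] {n : ℕ} (L : AddSubgroup (Fin n → ℤ)) :
    (1 < LatticeIdeal.latticeRank (LatticeIdeal.pureSublattice L) →
      (¬ ∃ B, LatticeIdeal.IsIndispensableBinomial (LatticeIdeal.latticeIdeal k L) B) ∧
      ∀ u, LatticeIdeal.IsIndispensableMonomial (LatticeIdeal.latticeIdeal k L) u ↔ u = 0) ∧
    (LatticeIdeal.latticeRank (LatticeIdeal.pureSublattice L) = 1 →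
      (∃ B, LatticeIdeal.IsIndispensableBinomial (LatticeIdeal.latticeIdeal k L) B ∧
        ∀ B', LatticeIdeal.IsIndispensableBinomial (LatticeIdeal.latticeIdeal k L) B' →
          ∃ c : k, c ≠ 0 ∧ B' = c • B) ∧
      {u | LatticeIdeal.IsIndispensableMonomial (LatticeIdeal.latticeIdeal k L) u}.ncard = 2) := by
  open LatticeIdeal in
  refine ⟨fun hr => ⟨?_, fun u => isIndispensableMonomial_iff_of_one_lt_rank hr⟩, fun hr => ?_⟩
  · rintro ⟨B, hB⟩
    exact not_isIndispensableBinomial_of_one_lt_rank hr hB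
  · obtain ⟨w, hw⟩ := exists_isPositiveBasis_singleton hr
    have hmonomials : {u | IsIndispensableMonomial (latticeIdeal k L) u} = {0, w} :=
      Set.ext fun u => isIndispensableMonomial_iff hw
    have hw0 : 0 ≠ w := hw.zero_notMem
    refine ⟨⟨_, isIndispensableBinomial_sub hw, fun B hB => hB.exists_eq_smul_sub hw⟩, ?_⟩
    rw [hmonomials, Set.ncard_pair hw0]
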